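/- Let $z_0\neq z_1$ be complex numbers and let $\mathcal C$ be a contour from $z_0$ to $z_1$, parameterized by a continuous $c:[0,1]\to\mathbb C$ of finite length that has a continuous derivative except at finitely many points, with $c(0)=z_0$, $c(1)=z_1$ and $c(t)\ne z_0$ for $0<t\le 1$. Let $\mathcal N$ be a neighborhood of $z_0$, and let $p$ be holomorphic on a domain containing $\mathcal N\cup\mathcal C$, with $$p(z)=p(z_0)-p_0(z-z_0)^\mu(1-\phi(z))\qquad(z\in\mathcal N),$$ where $\mu\ge 1$ is an integer, $p_0\in\mathbb C\setminus\{0\}$, and $\phi$ is holomorphic on $\mathcal N$ with $\phi(z_0)=0$. For $k\in\mathbb Z$ put $\theta_k=-\arg(p_0)/\mu+2\pi k/\mu$, where $\arg$ takes values in $(-\pi,\pi]$. Suppose that, for some $k\in\mathbb Z$, the contour $\mathcal C$ initially runs outwards along the half-line $\{z_0+re^{i\theta_k}:r\ge 0\}$ (that is, for some $\delta>0$, $c(t)$ lies on this half-line and $|c(t)-z_0|$ is non-decreasing for $0\le t\le\delta$), and that $$\operatorname{Re}p(z)<\operatorname{Re}p(z_0)\quad\text{for all } z\in\mathcal C,\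 z\neq z_0.$$ Let $a\in\mathbb C$ with $\operatorname{Re}(a)>0$. On the initial part of $\mathcal C$ take $(z-z_0)^{a-1}=|z-z_0|^{a-1}e^{i\theta_k(a-1)}$, and continue this branch along the rest of $\mathcal C$ by continuity. All other powers below are principal. Then for every integer $S\ge 0$ there is a constant $C$ such that, for every $q$ holomorphic on a domain containing $\mathcal N\cup\mathcal C$, every bound $K_q$ for $|q|$ on $\mathcal N\cup\mathcal C$, and every real $N>0$, the integral below converges absolutely and $$\int_{\mathcal C}e^{Np(z)}(z-z_0)^{a-1}q(z)\,dz=e^{Np(z_0)}\left(\sum_{s=0}^{S-1}\Gamma\!\left(\frac{s+a}{\mu}\right)\frac{\alpha_s\,e^{2\pi ik(s+a)/\mu}}{N^{(s+a)/\mu}}+R\right),\qquad |R|\le \frac{C\,K_q}{N^{(S+\operatorname{Re}(a))/\mu}},$$ where $$\alpha_s=\frac{1}{\mu\,s!}\,p_0^{-(s+a)/\mu}\,\frac{d^s}{dz^s}\left\{q(z)\,(1-\phi(z))^{-(s+a)/\mu}\right\}_{z=z_0}.$$ In particular $C$ does not depend on $N$ or $q$. -/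

import Mathlib

open Set Filter Topology

noncomputable section

/-- `f` is holomorphic on a domain (a connected open set) containing `A`. -/
def HolomorphicOnDomainContaining (f : ℂ → ℂ) (A : Set ℂ) : Prop :=
  ∃ D : Set ℂ, IsOpen D ∧ IsConnected D ∧ A ⊆ D ∧ DifferentiableOn ℂ f D

/-- A contour: a continuous `c : [0,1] → ℂ` with a continuous derivative except at finitely many
points, of finite length. Only the values of `c` on `[0,1]` matter. -/
structure IsContour (c : ℝ → ℂ) : Prop where
  continuousOn : ContinuousOn c (Icc 0 1)
  piecewise_C1 : ∃ E : Set ℝ, E.Finite ∧ ContDiffOn ℝ 1 c (Ioo 0 1 \ E)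
  finite_length : IntervalIntegrable (deriv c) MeasureTheory.volume 0 1

/-- The steepest-descent (bisecting) angle `θ_ℓ = -arg(p₀)/μ + 2πℓ/μ`. -/
def steepestAngle (p₀ : ℂ) (μ : ℕ) (l : ℤ) : ℝ :=
  -(Complex.arg p₀) / (μ : ℝ) + 2 * Real.pi * (l : ℝ) / (μ : ℝ)

/-- The contour `c`, starting at `z₀`, initially runs (outwards) along the half-line
`{z₀ + r e^{iθ} : r ≥ 0}`. -/
def InitiallyRunsAlong (c : ℝ → ℂ) (z₀ : ℂ) (θ : ℝ) : Prop :=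
  ∃ δ ∈ Ioc (0 : ℝ) 1,
    (∀ t ∈ Icc (0 : ℝ) δ,
      c t = z₀ + ((‖c t - z₀‖ : ℝ) : ℂ) * Complex.exp (Complex.I * (θ : ℂ))) ∧
    MonotoneOn (fun t => ‖c t - z₀‖) (Icc 0 δ)

/-- `ϑ t` is the argument of `c t - z₀`, continued continuously along the contour for
`0 < t ≤ 1`, with the value `θ` on the initial part of the contour. -/
structure IsContinuousArgAlong (c : ℝ → ℂ) (z₀ : ℂ) (θ : ℝ) (ϑ : ℝ → ℝ) : Prop where
  continuousOn : ContinuousOn ϑ (Ioc 0 1)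
  polar : ∀ t ∈ Ioc (0 : ℝ) 1,
    c t - z₀ = ((‖c t - z₀‖ : ℝ) : ℂ) * Complex.exp (Complex.I * (ϑ t : ℂ))
  initial : ∀ᶠ t in 𝓝[>] (0 : ℝ), ϑ t = θ

/-- The branch `|w|^b e^{iϑb}` of the power `w^b`, where `ϑ` is the chosen argument of `w ≠ 0`. -/
def branchPow (w : ℂ) (ϑ : ℝ) (b : ℂ) : ℂ :=
  ((‖w‖ : ℝ) : ℂ) ^ b * Complex.exp (Complex.I * (ϑ : ℂ) * b)

/-- The integrand, pulled back to `[0,1]`, of `∫_c e^{N p(z)} (z - z₀)^{a-1} q(z) dz`, with the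
power taken along `c` by means of the argument function `ϑ`. -/
def perronIntegrand (c : ℝ → ℂ) (p q : ℂ → ℂ) (z₀ a : ℂ) (ϑ : ℝ → ℝ) (N t : ℝ) : ℂ :=
  Complex.exp ((N : ℂ) * p (c t)) * branchPow (c t - z₀) (ϑ t) (a - 1) * q (c t) * deriv c t

/-- The coefficient
`α_s = (1 / (μ s!)) p₀^{-(s+a)/μ} (d/dz)^s {q(z) (1 - φ(z))^{-(s+a)/μ}}` at `z = z₀`
(principal powers). -/
def perronCoeff (q φ : ℂ → ℂ) (z₀ p₀ a : ℂ) (μ s : ℕ) : ℂ :=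
  1 / ((μ : ℂ) * (s.factorial : ℂ)) * p₀ ^ (-((s : ℂ) + a) / (μ : ℂ)) *
    iteratedDeriv s (fun z => q z * (1 - φ z) ^ (-((s : ℂ) + a) / (μ : ℂ))) z₀

end

open MeasureTheory

/-! This is Perron's form of Laplace's method. On a short initial piece the contour is a ray on
which `p₀ (z - z₀) ^ μ` equals `‖p₀‖ r ^ μ`, so with `l = N ‖p₀‖` the integral becomes one of `r ^
(a - 1) e^{-l r^μ (1 - φ)} q` (`perronIntegrand_initial`). On the rest `Re p` stays below `Re p z₀`
by a fixed gap, and `perronIntegrand_tail` bounds the contribution exponentially.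

On the ray, `e^{l r^μ φ}` is cut to its first `S` exponential terms and each `φ ^ j * q` to its
Taylor polynomial of degree below `S`. The error is of size `r ^ S e^{-l r^μ / 4}`, which integrates
to the claimed power of `l`. The truncated model is integrated exactly over the whole half-line
(`laplaceModel_integral`): `Complex.Gamma_add_nat_eq` turns the shifted Gamma values into binomial
coefficients, and `iteratedDeriv_mul_one_sub_cpow_neg` resums these into the derivatives in
`perronCoeff`.

Uniformity in `q` comes from using only Cauchy estimates on one fixed disc, all linear in the bound
for `q`. -/

/-! ### Binomial resummation of the coefficients -/

theorem AnalyticAt.natCast_le_analyticOrderAt_of_isBigO {f : ℂ → ℂ} {z₀ : ℂ}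
    (hf : AnalyticAt ℂ f z₀) {n : ℕ} (h : f =O[𝓝 z₀] fun z => ‖z - z₀‖ ^ n) :
    (n : ℕ∞) ≤ analyticOrderAt f z₀ := by
  by_contra! hlt
  obtain ⟨m, hm⟩ := ENat.ne_top_iff_exists.1 hlt.ne_top
  rw [← hm, Nat.cast_lt] at hlt
  obtain ⟨g, hg, hg0, hfg⟩ := hf.analyticOrderAt_eq_natCast.1 hm.symm
  obtain ⟨C, hC⟩ := h.bound
  -- Dividing by `‖z - z₀‖ ^ m` leaves a positive power, which forces `g z₀ = 0`.
  have hle : ∀ᶠ z in 𝓝[≠] z₀, ‖g z‖ ≤ C * ‖z - z₀‖ ^ (n - m) := by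
    filter_upwards [hfg.filter_mono nhdsWithin_le_nhds, hC.filter_mono nhdsWithin_le_nhds,
      self_mem_nhdsWithin] with z h1 h2 h3
    have hpos : 0 < ‖z - z₀‖ ^ m := pow_pos (norm_pos_iff.2 (sub_ne_zero.2 h3)) _
    rw [h1, norm_smul, norm_pow, norm_pow, norm_norm, ← Nat.add_sub_of_le hlt.le, pow_add] at h2
    refine le_of_mul_le_mul_left ?_ hpos
    calc _ ≤ _ := h2
      _ = _ := by ring
  have hlim : Tendsto (fun z => C * ‖z - z₀‖ ^ (n - m)) (𝓝[≠] z₀) (𝓝 0) := by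
    have : ContinuousAt (fun z => C * ‖z - z₀‖ ^ (n - m)) z₀ := by fun_prop
    have h0 := this.tendsto
    simp only [sub_self, norm_zero, zero_pow (Nat.sub_ne_zero_of_lt hlt), mul_zero] at h0
    exact h0.mono_left nhdsWithin_le_nhds
  have hgl : Tendsto (fun z => ‖g z‖) (𝓝[≠] z₀) (𝓝 ‖g z₀‖) :=
    (hg.continuousAt.norm.tendsto).mono_left nhdsWithin_le_nhds
  exact hg0 (norm_le_zero_iff.1 (le_of_tendsto_of_tendsto hgl hlim hle))

/-- The binomial expansion of `(1 - φ)^{-b}` determines the Taylor coefficients of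
`q (1 - φ)^{-b}` at a zero of `φ`. -/
theorem iteratedDeriv_mul_one_sub_cpow_neg {q φ : ℂ → ℂ} {z₀ : ℂ} (hq : AnalyticAt ℂ q z₀)
    (hφ : AnalyticAt ℂ φ z₀) (hφ0 : φ z₀ = 0) (b : ℂ) {S m : ℕ} (hm : m < S) :
    iteratedDeriv m (fun z => q z * (1 - φ z) ^ (-b)) z₀ =
      ∑ j ∈ Finset.range S,
        Ring.choose (b + j - 1) j * iteratedDeriv m (fun z => φ z ^ j * q z) z₀ := by
  have hmain : AnalyticAt ℂ (fun z => q z * (1 - φ z) ^ (-b)) z₀ := by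
    refine hq.mul ((analyticAt_const.sub hφ).cpow analyticAt_const ?_)
    simp [hφ0]
  have hterm : ∀ j : ℕ, AnalyticAt ℂ (fun z => φ z ^ j * q z) z₀ := fun j => (hφ.pow j).mul hq
  have hsum : AnalyticAt ℂ (fun z => ∑ j ∈ Finset.range S,
      Ring.choose (b + j - 1) j * (φ z ^ j * q z)) z₀ :=
    Finset.analyticAt_fun_sum _ fun j _ => analyticAt_const.mul (hterm j)
  have hO : (fun x : ℂ => 1 / (1 - x) ^ b -
      ∑ j ∈ Finset.range S, Ring.choose (b + j - 1) j * x ^ j) =O[𝓝 0] fun x => ‖x‖ ^ S := by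
    have h := (Complex.one_div_one_sub_cpow_hasFPowerSeriesOnBall_zero
      b).hasFPowerSeriesAt.isBigO_sub_partialSum_pow S
    refine h.congr_left fun x => ?_
    simp [FormalMultilinearSeries.partialSum, mul_comm]
  have hφt : Tendsto φ (𝓝 z₀) (𝓝 0) := by simpa [hφ0] using hφ.continuousAt.tendsto
  have hO1 := hO.comp_tendsto hφt
  have hφO : φ =O[𝓝 z₀] fun z => z - z₀ := by
    have := hφ.differentiableAt.isBigO_sub
    simpa [hφ0] using this
  -- The binomial remainder at `x = φ z` is of order `S` because `φ` vanishes at `z₀`; such an error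
  -- has no derivatives of order below `S` there.
  have hO2 : (fun z => q z * (1 - φ z) ^ (-b) - ∑ j ∈ Finset.range S,
      Ring.choose (b + j - 1) j * (φ z ^ j * q z)) =O[𝓝 z₀] fun z => ‖z - z₀‖ ^ S := by
    have h1 := ((hq.continuousAt.isBigO_one ℝ).mul hO1).trans
      ((Asymptotics.isBigO_refl (fun _ : ℂ => (1 : ℝ)) _).mul ((hφO.norm_norm).pow S))
    refine (h1.congr_left fun z => ?_).congr_right fun z => by simp
    simp only [Function.comp_apply, Complex.cpow_neg, one_div, mul_sub, Finset.mul_sum]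
    congr 1
    exact Finset.sum_congr rfl fun j _ => by ring
  have hdiff := hmain.sub hsum
  have hord : (S : ℕ∞) ≤ analyticOrderAt ((fun z => q z * (1 - φ z) ^ (-b)) - fun z =>
      ∑ j ∈ Finset.range S, Ring.choose (b + j - 1) j * (φ z ^ j * q z)) z₀ :=
    hdiff.natCast_le_analyticOrderAt_of_isBigO hO2
  have hz := (natCast_le_analyticOrderAt_iff_iteratedDeriv_eq_zero hdiff).1 hord m hm
  rw [iteratedDeriv_sub hmain.contDiffAt hsum.contDiffAt, sub_eq_zero] at hz
  have hcm : ∀ j ∈ Finset.range S, ContDiffAt ℂ m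
      (fun z => Ring.choose (b + j - 1) j * (φ z ^ j * q z)) z₀ :=
    fun j _ => (analyticAt_const.mul (hterm j)).contDiffAt
  rw [hz, iteratedDeriv_fun_sum hcm]
  refine Finset.sum_congr rfl fun j _ => ?_
  rw [iteratedDeriv_const_mul_field]

/-- Iterating the functional equation gives the rising factorial of `b`, which is `j!` times the
coefficient of `x ^ j` in `(1 - x) ^ (-b)`. -/
theorem Complex.Gamma_add_nat_eq {b : ℂ} (hb : 0 < b.re) (j : ℕ) :
    Complex.Gamma (b + j) = j.factorial * Ring.choose (b + j - 1) j * Complex.Gamma b := by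
  have h1 : (j.factorial : ℂ) * Ring.choose (b + j - 1) j = (ascPochhammer ℂ j).eval b := by
    rw [Ring.choose, ← nsmul_eq_mul, Ring.factorial_nsmul_multichoose_eq_ascPochhammer,
      Polynomial.ascPochhammer_smeval_eq_eval]
    congr 1; ring
  rw [h1]
  induction j with
  | zero => simp
  | succ j ih =>
    have hne : b + j ≠ 0 := fun h => by
      have := congrArg Complex.re h
      simp at this
      have : (0:ℝ) ≤ j := Nat.cast_nonneg j
      linarith
    rw [ascPochhammer_succ_eval, Nat.cast_succ, ← add_assoc, Complex.Gamma_add_one _ hne, ih]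
    · ring
    · rw [Ring.choose, ← nsmul_eq_mul, Ring.factorial_nsmul_multichoose_eq_ascPochhammer,
        Polynomial.ascPochhammer_smeval_eq_eval]
      congr 1; ring

/-! ### Uniform Taylor remainders -/

/-- Cauchy's estimate for the Taylor coefficients. -/
theorem norm_taylorCoeff_le {g : ℂ → ℂ} {z₀ : ℂ} {R M : ℝ} (hR : 0 < R)
    (hg : DifferentiableOn ℂ g (Metric.closedBall z₀ R))
    (hM : ∀ z ∈ Metric.closedBall z₀ R, ‖g z‖ ≤ M) (m : ℕ) :
    ‖iteratedDeriv m g z₀ / m.factorial‖ ≤ M / R ^ m := by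
  have h := Complex.norm_iteratedDeriv_le_of_forall_mem_sphere_norm_le m hR
    (hg.mono Metric.closure_ball_subset_closedBall).diffContOnCl
    fun z hz => hM z (Metric.sphere_subset_closedBall hz)
  rw [norm_div, Complex.norm_natCast, div_le_iff₀ (by positivity)]
  calc _ ≤ _ := h
    _ = _ := by ring

/-- Cauchy's estimate dominates the Taylor tail by a geometric series of ratio at most `1 / 2`,
whence the factor 2. -/
theorem norm_sub_taylorPoly_le {g : ℂ → ℂ} {z₀ : ℂ} {R M : ℝ} (hR : 0 < R)
    (hg : DifferentiableOn ℂ g (Metric.closedBall z₀ R))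
    (hM : ∀ z ∈ Metric.closedBall z₀ R, ‖g z‖ ≤ M) (S : ℕ) {z : ℂ} (hz : ‖z - z₀‖ ≤ R / 2) :
    ‖g z - ∑ m ∈ Finset.range S, iteratedDeriv m g z₀ / m.factorial * (z - z₀) ^ m‖ ≤
      2 * M * (‖z - z₀‖ / R) ^ S := by
  have hM0 : 0 ≤ M := (norm_nonneg _).trans (hM z₀ (Metric.mem_closedBall_self hR.le))
  have hzb : z ∈ Metric.ball z₀ R := by
    rw [Metric.mem_ball, dist_eq_norm]; linarith
  have hs := Complex.hasSum_taylorSeries_on_ball (hg.mono Metric.ball_subset_closedBall) hzb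
  have hs' : HasSum (fun m : ℕ => iteratedDeriv m g z₀ / m.factorial * (z - z₀) ^ m) (g z) := by
    refine hs.congr_fun fun m => ?_
    simp only [smul_eq_mul]; ring
  have htail := (hasSum_nat_add_iff' S).2 hs'
  set u := ‖z - z₀‖ / R with hu
  have hu0 : 0 ≤ u := by positivity
  have hu1 : u ≤ 1 / 2 := by rw [hu, div_le_iff₀ hR]; linarith
  have hgeo := (hasSum_geometric_two).mul_left (M * u ^ S)
  rw [← htail.tsum_eq]
  have hb : ∀ n : ℕ, ‖iteratedDeriv (n + S) g z₀ / ((n + S).factorial : ℂ) * (z - z₀) ^ (n + S)‖ ≤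
      M * u ^ S * (1 / 2) ^ n := by
    intro n
    rw [norm_mul, norm_pow]
    calc _ ≤ M / R ^ (n + S) * ‖z - z₀‖ ^ (n + S) := by
          gcongr; exact norm_taylorCoeff_le hR hg hM _
      _ = M * u ^ S * u ^ n := by rw [hu, div_pow, div_pow]; field_simp; ring
      _ ≤ _ := by gcongr
  refine (tsum_of_norm_bounded hgeo hb).trans (le_of_eq (by ring))

/-! ### Pointwise truncation of the exponential -/

/-- Only half of the exponent is spent, so a factor `e^{-x}` still leaves decay `e^{-x/2}`. -/
theorem sum_pow_div_factorial_le {x : ℝ} (hx : 0 ≤ x) (S : ℕ) :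
    ∑ j ∈ Finset.range S, x ^ j / j.factorial ≤ 2 ^ S * Real.exp (x / 2) := by
  calc ∑ j ∈ Finset.range S, x ^ j / j.factorial ≤ ∑ j ∈ Finset.range S, 2 ^ S * ((x / 2) ^ j / j.factorial) := by
        refine Finset.sum_le_sum fun j hj => ?_
        have : x ^ j / j.factorial = 2 ^ j * ((x / 2) ^ j / j.factorial) := by
          rw [div_pow]; field_simp
        rw [this]
        gcongr
        · norm_num
        · exact (Finset.mem_range.1 hj).le
    _ = 2 ^ S * ∑ j ∈ Finset.range S, (x / 2) ^ j / j.factorial := by rw [Finset.mul_sum]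
    _ ≤ _ := by gcongr; exact Real.sum_le_exp_of_nonneg (by positivity) S

theorem norm_exp_mul_sum_le {x B : ℝ} (hx : 0 ≤ x) (S : ℕ) {t : ℕ → ℂ}
    (ht : ∀ j < S, ‖t j‖ ≤ B) (hB : 0 ≤ B) :
    ‖Complex.exp (-(x : ℂ)) * ∑ j ∈ Finset.range S, ((x : ℂ) ^ j / j.factorial) * t j‖ ≤
      2 ^ S * B * Real.exp (-(x / 2)) := by
  have h : ‖∑ j ∈ Finset.range S, ((x : ℂ) ^ j / j.factorial) * t j‖ ≤ 2 ^ S * Real.exp (x / 2) * B := by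
    calc _ ≤ ∑ j ∈ Finset.range S, (x ^ j / j.factorial) * B := by
          refine norm_sum_le_of_le _ fun j hj => ?_
          rw [norm_mul, norm_div, norm_pow, Complex.norm_real, Complex.norm_natCast,
            Real.norm_of_nonneg hx]
          gcongr
          exact ht j (Finset.mem_range.1 hj)
      _ = (∑ j ∈ Finset.range S, (x ^ j / j.factorial)) * B := by rw [Finset.sum_mul]
      _ ≤ _ := by gcongr; exact sum_pow_div_factorial_le hx S
  rw [norm_mul, Complex.norm_exp]
  have he : Real.exp (-x) * Real.exp (x / 2) = Real.exp (-(x / 2)) := by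
    rw [← Real.exp_add]; ring_nf
  calc _ ≤ Real.exp (-x) * (2 ^ S * Real.exp (x / 2) * B) := by
        gcongr; simp
    _ = 2 ^ S * B * (Real.exp (-x) * Real.exp (x / 2)) := by ring
    _ = _ := by rw [he]

/-- Two errors are added: cutting the series of `e^{xψ}`, and replacing `ψ ^ j * Q` by `t j`. Each
carries a factor `u ^ S`. -/
theorem norm_exp_mul_sub_sum_le {x K u : ℝ} (hx : 0 ≤ x) (hu : 0 ≤ u) (S : ℕ) {ψ Q : ℂ}
    {t : ℕ → ℂ} (hψ : ‖ψ‖ ≤ 1 / 2) (hψu : ‖ψ‖ ≤ u) (hQ : ‖Q‖ ≤ K)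
    (ht : ∀ j < S, ‖ψ ^ j * Q - t j‖ ≤ 2 * K * u ^ S) :
    ‖Complex.exp (-(x * (1 - ψ))) * Q -
      Complex.exp (-(x : ℂ)) * ∑ j ∈ Finset.range S, ((x : ℂ) ^ j / j.factorial) * t j‖ ≤
      (4 ^ S * S.factorial + 2 ^ S * 2) * K * u ^ S * Real.exp (-(x / 4)) := by
  have hK : 0 ≤ K := (norm_nonneg _).trans hQ
  have hsplit : Complex.exp (-(x * (1 - ψ))) * Q -
      Complex.exp (-(x : ℂ)) * ∑ j ∈ Finset.range S, ((x : ℂ) ^ j / j.factorial) * t j =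
      Complex.exp (-(x : ℂ)) *
        (Complex.exp (x * ψ) - ∑ j ∈ Finset.range S, (x * ψ) ^ j / j.factorial) * Q +
      Complex.exp (-(x : ℂ)) *
        ∑ j ∈ Finset.range S, ((x : ℂ) ^ j / j.factorial) * (ψ ^ j * Q - t j) := by
    have h1 : Complex.exp (-(x * (1 - ψ))) = Complex.exp (-(x : ℂ)) * Complex.exp (x * ψ) := by
      rw [← Complex.exp_add]; ring_nf
    have h2 : ∑ j ∈ Finset.range S, ((x : ℂ) ^ j / j.factorial) * (ψ ^ j * Q - t j) =
        (∑ j ∈ Finset.range S, (x * ψ) ^ j / j.factorial) * Q -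
          ∑ j ∈ Finset.range S, ((x : ℂ) ^ j / j.factorial) * t j := by
      rw [Finset.sum_mul, ← Finset.sum_sub_distrib]
      exact Finset.sum_congr rfl fun j _ => by rw [mul_pow]; ring
    rw [h1, h2]; ring
  have hxψ : ‖(x : ℂ) * ψ‖ = x * ‖ψ‖ := by
    rw [norm_mul, Complex.norm_real, Real.norm_of_nonneg hx]
  -- The remainder `(x‖ψ‖)^S e^{x‖ψ‖}` costs `e^{x/2}` since `‖ψ‖ ≤ 1/2`, and absorbing `x ^ S`
  -- costs `e^{x/4}`; out of `e^{-x}` there remains `e^{-x/4}`.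
  have hfac : (x / 4) ^ S ≤ S.factorial * Real.exp (x / 4) := by
    have := Real.pow_div_factorial_le_exp (x / 4) (by positivity) S
    rwa [div_le_iff₀ (by positivity), mul_comm] at this
  have hA : ‖Complex.exp (-(x : ℂ)) *
      (Complex.exp (x * ψ) - ∑ j ∈ Finset.range S, (x * ψ) ^ j / j.factorial) * Q‖ ≤
      4 ^ S * S.factorial * K * u ^ S * Real.exp (-(x / 4)) := by
    rw [norm_mul, norm_mul, Complex.norm_exp]
    have h := Complex.norm_exp_sub_sum_le_norm_mul_exp (x * ψ) S
    rw [hxψ] at h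
    have he : Real.exp (-x) * (Real.exp (x / 4) * Real.exp (x / 2)) = Real.exp (-(x / 4)) := by
      rw [← Real.exp_add, ← Real.exp_add]; ring_nf
    have hx4 : x ^ S = 4 ^ S * (x / 4) ^ S := by rw [div_pow]; field_simp
    calc _ ≤ Real.exp (-x) * ((x * ‖ψ‖) ^ S * Real.exp (x * ‖ψ‖)) * K := by
          gcongr; simp
      _ ≤ Real.exp (-x) * ((x * u) ^ S * Real.exp (x / 2)) * K := by
          gcongr
          nlinarith
      _ = Real.exp (-x) * ((4 ^ S * (x / 4) ^ S) * u ^ S * Real.exp (x / 2)) * K := by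
          rw [mul_pow, ← hx4]
      _ ≤ Real.exp (-x) * ((4 ^ S * (S.factorial * Real.exp (x / 4))) * u ^ S * Real.exp (x / 2)) * K := by
          gcongr
      _ = 4 ^ S * S.factorial * K * u ^ S * (Real.exp (-x) * (Real.exp (x / 4) * Real.exp (x / 2))) := by
          ring
      _ = _ := by rw [he]
  have hB := norm_exp_mul_sum_le hx S ht (by positivity)
  rw [hsplit]
  refine (norm_add_le_of_le hA hB).trans ?_
  have : Real.exp (-(x / 2)) ≤ Real.exp (-(x / 4)) := Real.exp_le_exp.2 (by linarith)
  calc _ ≤ 4 ^ S * S.factorial * K * u ^ S * Real.exp (-(x / 4)) +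
        2 ^ S * (2 * K * u ^ S) * Real.exp (-(x / 4)) := by gcongr
    _ = _ := by ring

/-! ### Gamma integrals on the half-line -/

theorem integrableOn_cpow_mul_exp_neg_mul_pow {β : ℂ} (hβ : 0 < β.re) {l : ℝ} (hl : 0 < l)
    {μ : ℕ} (hμ : 1 ≤ μ) :
    IntegrableOn (fun r : ℝ => (r : ℂ) ^ (β - 1) * Complex.exp (-((l * r ^ μ : ℝ) : ℂ)))
      (Ioi 0) := by
  have hreal := integrableOn_rpow_mul_exp_neg_mul_rpow (p := μ) (s := β.re - 1) (b := l)
    (by linarith) (by exact_mod_cast hμ) hl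
  refine Integrable.mono' hreal ?_ ?_
  · refine ContinuousOn.aestronglyMeasurable (fun r hr => ?_) measurableSet_Ioi
    refine ContinuousAt.continuousWithinAt (ContinuousAt.mul ?_ (by fun_prop))
    exact (continuousAt_cpow_const (Complex.ofReal_mem_slitPlane.2 hr)).comp (by fun_prop)
  · refine (ae_restrict_iff' measurableSet_Ioi).2 (ae_of_all _ fun r hr => ?_)
    rw [norm_mul, Complex.norm_cpow_eq_rpow_re_of_pos hr, Complex.norm_exp, Complex.neg_re,
      Complex.ofReal_re, Real.rpow_natCast, neg_mul]
    simp

/-- Euler's integral after the substitution `t = r ^ μ`; the complex powers combine because their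
bases are positive reals. -/
theorem integral_cpow_mul_exp_neg_mul_pow {β : ℂ} (hβ : 0 < β.re) {l : ℝ} (hl : 0 < l)
    {μ : ℕ} (hμ : 1 ≤ μ) :
    ∫ r in Ioi (0 : ℝ), (r : ℂ) ^ (β - 1) * Complex.exp (-((l * r ^ μ : ℝ) : ℂ)) =
      (l : ℂ) ^ (-(β / μ)) * (Complex.Gamma (β / μ) / μ) := by
  have hμ0 : (0 : ℝ) < μ := by exact_mod_cast hμ
  have hμc : (μ : ℂ) ≠ 0 := by exact_mod_cast hμ0.ne'
  have hre : 0 < (β / μ).re := by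
    rw [Complex.div_natCast_re]; positivity
  have h1 := integral_comp_rpow_Ioi_of_pos
    (g := fun t : ℝ => (t : ℂ) ^ (β / μ - 1) * Complex.exp (-((l : ℂ) * t))) hμ0
  have h2 := Complex.integral_cpow_mul_exp_neg_mul_Ioi (r := l) hre (by simpa using hl)
  rw [h2] at h1
  have h3 : (1 / (l : ℂ)) ^ (β / μ) = (l : ℂ) ^ (-(β / μ)) := by
    rw [one_div, Complex.inv_cpow _ _ (by
      rw [Complex.arg_ofReal_of_nonneg hl.le]; exact Real.pi_pos.ne), Complex.cpow_neg]
  rw [h3] at h1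
  have h4 : ∀ r ∈ Ioi (0 : ℝ), ((μ : ℝ) * r ^ ((μ : ℝ) - 1)) •
      (((r ^ (μ : ℝ) : ℝ) : ℂ) ^ (β / μ - 1) * Complex.exp (-((l : ℂ) * (r ^ (μ : ℝ) : ℝ)))) =
      μ * ((r : ℂ) ^ (β - 1) * Complex.exp (-((l * r ^ μ : ℝ) : ℂ))) := by
    intro r hr
    have hr0 : (r : ℂ) ≠ 0 := by exact_mod_cast (ne_of_gt hr)
    have e1 : ((r ^ (μ : ℝ) : ℝ) : ℂ) ^ (β / μ - 1) = (r : ℂ) ^ (β - μ) := by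
      have harg : (r : ℂ).arg = 0 := Complex.arg_ofReal_of_nonneg (le_of_lt hr)
      rw [Real.rpow_natCast, Complex.ofReal_pow, ← Complex.cpow_nat_mul'
        (by rw [harg, mul_zero]; exact neg_lt_zero.2 Real.pi_pos)
        (by rw [harg, mul_zero]; exact Real.pi_pos.le)]
      congr 1; field_simp
    have e2 : ((r ^ ((μ : ℝ) - 1) : ℝ) : ℂ) = (r : ℂ) ^ ((μ : ℂ) - 1) := by
      rw [Complex.ofReal_cpow (le_of_lt hr)]; push_cast; rfl
    rw [e1, Complex.real_smul, Complex.ofReal_mul, e2, Real.rpow_natCast]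
    have e3 : (r : ℂ) ^ (β - 1) = (r : ℂ) ^ ((μ : ℂ) - 1) * (r : ℂ) ^ (β - μ) := by
      rw [← Complex.cpow_add _ _ hr0]; ring_nf
    rw [e3]; push_cast; ring
  rw [setIntegral_congr_fun measurableSet_Ioi h4, integral_const_mul] at h1
  rw [mul_div_assoc', eq_div_iff hμc, ← h1, mul_comm]

/-! ### Watson's lemma along a ray -/

/-- The model integrand `e^{-l r^μ} ∑_{j,m<S} (l r^μ)^j / j! · d j m · (r E)^m`. -/
noncomputable def laplaceModel (S μ : ℕ) (l : ℝ) (E : ℂ) (d : ℕ → ℕ → ℂ) (r : ℝ) : ℂ :=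
  Complex.exp (-((l * r ^ μ : ℝ) : ℂ)) * ∑ j ∈ Finset.range S,
    (((l * r ^ μ : ℝ) : ℂ) ^ j / j.factorial) * ∑ m ∈ Finset.range S, d j m * (r * E) ^ m

/-- In the `(j, m)` term the integral contributes `l ^ (-(m + a) / μ - j)`, so the prefactor `l ^ j`
cancels and the power of `l` depends on `m` alone. This lets the sum over `j` be collected. -/
theorem laplaceModel_integral {a : ℂ} (ha : 0 < a.re) {l : ℝ} (hl : 0 < l) {μ : ℕ} (hμ : 1 ≤ μ)
    (S : ℕ) (E : ℂ) (d : ℕ → ℕ → ℂ) :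
    IntegrableOn (fun r : ℝ => (r : ℂ) ^ (a - 1) * laplaceModel S μ l E d r) (Ioi 0) ∧
    ∫ r in Ioi (0 : ℝ), (r : ℂ) ^ (a - 1) * laplaceModel S μ l E d r =
      ∑ m ∈ Finset.range S, (l : ℂ) ^ (-((m + a) / μ)) * (Complex.Gamma ((m + a) / μ) / μ) * E ^ m *
        ∑ j ∈ Finset.range S, Ring.choose ((m + a) / μ + j - 1) j * d j m := by
  have hμc : (μ : ℂ) ≠ 0 := by exact_mod_cast (by omega : μ ≠ 0)
  have hlc : (l : ℂ) ≠ 0 := by exact_mod_cast hl.ne'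
  have hre : ∀ m j : ℕ, 0 < (a + m + μ * j).re := fun m j => by
    simp only [Complex.add_re, Complex.natCast_re, ← Nat.cast_mul]
    positivity
  set f : ℕ → ℕ → ℝ → ℂ := fun m j r => (d j m / j.factorial * (l : ℂ) ^ j * E ^ m) *
    ((r : ℂ) ^ (a + m + μ * j - 1) * Complex.exp (-((l * r ^ μ : ℝ) : ℂ))) with hf
  have hfi : ∀ m j, IntegrableOn (f m j) (Ioi 0) := fun m j =>
    (integrableOn_cpow_mul_exp_neg_mul_pow (hre m j) hl hμ).const_mul _
  have hsum : ∀ r ∈ Ioi (0 : ℝ), (r : ℂ) ^ (a - 1) * laplaceModel S μ l E d r =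
      ∑ m ∈ Finset.range S, ∑ j ∈ Finset.range S, f m j r := by
    intro r hr
    have hr0 : (r : ℂ) ≠ 0 := by exact_mod_cast (ne_of_gt hr)
    rw [laplaceModel, Finset.sum_comm]
    simp only [Finset.mul_sum]
    refine Finset.sum_congr rfl fun j _ => Finset.sum_congr rfl fun m _ => ?_
    have e : (r : ℂ) ^ (a + m + μ * j - 1) = (r : ℂ) ^ (a - 1) * (r : ℂ) ^ m * (r : ℂ) ^ (μ * j) := by
      rw [← Complex.cpow_natCast, ← Complex.cpow_natCast, ← Complex.cpow_add _ _ hr0,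
        ← Complex.cpow_add _ _ hr0]
      congr 1; push_cast; ring
    simp only [hf]
    rw [e]; push_cast; ring
  have hint : IntegrableOn (fun r => ∑ m ∈ Finset.range S, ∑ j ∈ Finset.range S, f m j r) (Ioi 0) :=
    integrable_finsetSum _ fun m _ => integrable_finsetSum _ fun j _ => hfi m j
  refine ⟨hint.congr_fun (fun r hr => (hsum r hr).symm) measurableSet_Ioi, ?_⟩
  rw [setIntegral_congr_fun measurableSet_Ioi hsum,
    integral_finsetSum _ fun m _ => integrable_finsetSum _ fun j _ => hfi m j]
  refine Finset.sum_congr rfl fun m _ => ?_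
  rw [integral_finsetSum _ fun j _ => hfi m j, Finset.mul_sum]
  refine Finset.sum_congr rfl fun j _ => ?_
  have hb : 0 < (((m : ℂ) + a) / μ).re := by
    rw [Complex.div_natCast_re]
    have : (0 : ℝ) < μ := by exact_mod_cast hμ
    simp only [Complex.add_re, Complex.natCast_re]; positivity
  have hdiv : (a + m + μ * j) / μ = (m + a) / μ + j := by field_simp; ring
  simp only [hf]
  rw [integral_const_mul, integral_cpow_mul_exp_neg_mul_pow (hre m j) hl hμ, hdiv,
    Complex.Gamma_add_nat_eq hb, neg_add, Complex.cpow_add _ _ hlc, Complex.cpow_neg (l : ℂ) j,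
    Complex.cpow_natCast]
  have : (j.factorial : ℂ) ≠ 0 := by exact_mod_cast j.factorial_ne_zero
  field_simp

/-- The integrand `e^{-l r^μ (1 - φ)} q` along the ray `r ↦ z₀ + r E`. -/
noncomputable def laplaceRay (q φ : ℂ → ℂ) (z₀ E : ℂ) (μ : ℕ) (l r : ℝ) : ℂ :=
  Complex.exp (-(((l * r ^ μ : ℝ) : ℂ) * (1 - φ (z₀ + r * E)))) * q (z₀ + r * E)

/-- The Taylor coefficients at `z₀` of the functions `φ ^ j * q`. -/
noncomputable def powTaylorCoeff (q φ : ℂ → ℂ) (z₀ : ℂ) (j m : ℕ) : ℂ :=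
  iteratedDeriv m (fun z => φ z ^ j * q z) z₀ / m.factorial

/-- The constant in the pointwise comparison of `laplaceRay` with `laplaceModel`. -/
noncomputable def laplaceConst (S : ℕ) (R ρ : ℝ) : ℝ :=
  4 ^ S * S.factorial + 2 ^ S * 2 + 2 ^ S * (S * (R / ρ) ^ S)

section
variable {q φ : ℂ → ℂ} {z₀ E : ℂ} {R K ρ l r : ℝ} {μ : ℕ}

theorem norm_pow_mul_le_of_norm_le {z : ℂ} (j : ℕ) (h1 : ‖φ z‖ ≤ 1 / 2) (h2 : ‖q z‖ ≤ K) :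
    ‖φ z ^ j * q z‖ ≤ K := by
  rw [norm_mul, norm_pow]
  have : ‖φ z‖ ^ j ≤ 1 := pow_le_one₀ (norm_nonneg _) (by linarith)
  calc _ ≤ 1 * K := mul_le_mul this h2 (norm_nonneg _) zero_le_one
    _ = K := one_mul K

theorem norm_laplaceRay_sub_model_le (hR : 0 < R)
    (hφ : DifferentiableOn ℂ φ (Metric.closedBall z₀ R))
    (hφb : ∀ z ∈ Metric.closedBall z₀ R, ‖φ z‖ ≤ 1 / 2) (hφ0 : φ z₀ = 0)
    (hq : DifferentiableOn ℂ q (Metric.closedBall z₀ R))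
    (hqb : ∀ z ∈ Metric.closedBall z₀ R, ‖q z‖ ≤ K) (hE : ‖E‖ = 1) (hl : 0 < l) (S : ℕ)
    (hr : 0 < r) (hrR : r ≤ R / 2) :
    ‖laplaceRay q φ z₀ E μ l r - laplaceModel S μ l E (powTaylorCoeff q φ z₀) r‖ ≤
      (4 ^ S * S.factorial + 2 ^ S * 2) * K * (r / R) ^ S * Real.exp (-(l * r ^ μ / 4)) := by
  have hw : ‖z₀ + r * E - z₀‖ = r := by
    rw [add_sub_cancel_left, norm_mul, hE, Complex.norm_real, mul_one, Real.norm_of_nonneg hr.le]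
  have hmem : z₀ + r * E ∈ Metric.closedBall z₀ R := by
    rw [Metric.mem_closedBall, dist_eq_norm, hw]; linarith
  -- Taylor remainder of order 1 with bound `1 / 2`: the factor `2 * (1 / 2)` disappears.
  have hu : ‖φ (z₀ + r * E)‖ ≤ r / R := by
    have := norm_sub_taylorPoly_le hR hφ hφb 1 (z := z₀ + r * E) (by rw [hw]; exact hrR)
    rw [hw] at this
    simpa [hφ0] using this
  refine norm_exp_mul_sub_sum_le (by positivity) (by positivity) S (hφb _ hmem) hu
    (hqb _ hmem) fun j _ => ?_
  have := norm_sub_taylorPoly_le (g := fun z => φ z ^ j * q z) hR ((hφ.pow j).mul hq)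
    (fun z hz => norm_pow_mul_le_of_norm_le j (hφb z hz) (hqb z hz)) S
    (z := z₀ + r * E) (by rw [hw]; exact hrR)
  rw [hw] at this
  simpa [powTaylorCoeff] using this

/-- Past `ρ` the cut-off ray integrand is zero, so the model itself is the error. No cancellation is
needed: as `r` is bounded below, every lower power of `r` is a constant times `r ^ S`. -/
theorem norm_laplaceModel_le (hR : 0 < R)
    (hφ : DifferentiableOn ℂ φ (Metric.closedBall z₀ R))
    (hφb : ∀ z ∈ Metric.closedBall z₀ R, ‖φ z‖ ≤ 1 / 2)
    (hq : DifferentiableOn ℂ q (Metric.closedBall z₀ R))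
    (hqb : ∀ z ∈ Metric.closedBall z₀ R, ‖q z‖ ≤ K) (hE : ‖E‖ = 1) (hl : 0 < l) (S : ℕ)
    (hρ : 0 < ρ) (hρR : ρ ≤ R) (hr : ρ < r) :
    ‖laplaceModel S μ l E (powTaylorCoeff q φ z₀) r‖ ≤
      2 ^ S * (S * (R / ρ) ^ S) * K * (r / R) ^ S * Real.exp (-(l * r ^ μ / 4)) := by
  have hr0 : 0 < r := hρ.trans hr
  have hK : 0 ≤ K := (norm_nonneg _).trans (hqb z₀ (Metric.mem_closedBall_self hR.le))
  have h1 : 1 ≤ R / ρ := (one_le_div hρ).2 hρR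
  have hcoef : ∀ j < S, ‖∑ m ∈ Finset.range S, powTaylorCoeff q φ z₀ j m * (r * E) ^ m‖ ≤
      S * (R / ρ) ^ S * K * (r / R) ^ S := by
    intro j _
    have : ∀ m ∈ Finset.range S, ‖powTaylorCoeff q φ z₀ j m * (r * E) ^ m‖ ≤
        (R / ρ) ^ S * K * (r / R) ^ S := by
      intro m hm
      have hmS := (Finset.mem_range.1 hm).le
      rw [norm_mul, norm_pow, norm_mul, hE, mul_one, Complex.norm_real, Real.norm_of_nonneg hr0.le]
      have h2 := norm_taylorCoeff_le hR ((hφ.pow j).mul hq)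
        (fun z hz => norm_pow_mul_le_of_norm_le j (hφb z hz) (hqb z hz)) m
      -- A factor at least 1, as `r / ρ ≥ 1`, that raises the exponents of `r / R` and `R / ρ` to
      -- exactly `S`.
      have h3 : (1 : ℝ) ≤ (R / ρ) ^ m * ((R / ρ) * (r / R)) ^ (S - m) := by
        refine one_le_mul_of_one_le_of_one_le (one_le_pow₀ h1) (one_le_pow₀ ?_)
        rw [div_mul_div_cancel₀' hR.ne', one_le_div hρ]
        exact hr.le
      calc _ ≤ K / R ^ m * r ^ m := by gcongr; exact h2
        _ = K * (r / R) ^ m * 1 := by rw [div_pow]; ring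
        _ ≤ K * (r / R) ^ m * ((R / ρ) ^ m * ((R / ρ) * (r / R)) ^ (S - m)) := by gcongr
        _ = ((R / ρ) ^ m * (R / ρ) ^ (S - m)) * K * ((r / R) ^ m * (r / R) ^ (S - m)) := by
            rw [mul_pow]; ring
        _ = _ := by rw [← pow_add, ← pow_add, Nat.add_sub_of_le hmS]
    refine (norm_sum_le_of_le _ this).trans (le_of_eq ?_)
    rw [Finset.sum_const, Finset.card_range, nsmul_eq_mul]; ring
  refine (norm_exp_mul_sum_le (x := l * r ^ μ) (by positivity) S hcoef (by positivity)).trans ?_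
  have : Real.exp (-(l * r ^ μ / 2)) ≤ Real.exp (-(l * r ^ μ / 4)) :=
    Real.exp_le_exp.2 (by linarith [show 0 < l * r ^ μ by positivity])
  calc _ ≤ 2 ^ S * (S * (R / ρ) ^ S * K * (r / R) ^ S) * Real.exp (-(l * r ^ μ / 4)) := by gcongr
    _ = _ := by ring

end

/-- Watson's lemma along a ray, with an error bound uniform in the amplitude `q` and in `l`. -/
theorem laplaceRay_asymptotics {φ : ℂ → ℂ} {z₀ E : ℂ} {R ρ : ℝ} {μ : ℕ} (hR : 0 < R)
    (hφ : DifferentiableOn ℂ φ (Metric.closedBall z₀ R))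
    (hφb : ∀ z ∈ Metric.closedBall z₀ R, ‖φ z‖ ≤ 1 / 2) (hφ0 : φ z₀ = 0)
    (hE : ‖E‖ = 1) (hρ : 0 < ρ) (hρR : ρ ≤ R / 2) {a : ℂ} (ha : 0 < a.re) (hμ : 1 ≤ μ) (S : ℕ) :
    ∃ C : ℝ, ∀ (q : ℂ → ℂ) (K : ℝ), DifferentiableOn ℂ q (Metric.closedBall z₀ R) →
      (∀ z ∈ Metric.closedBall z₀ R, ‖q z‖ ≤ K) → ∀ l : ℝ, 0 < l →
      IntegrableOn (fun r : ℝ => (r : ℂ) ^ (a - 1) * laplaceRay q φ z₀ E μ l r) (Icc 0 ρ) ∧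
      ‖(∫ r in Icc 0 ρ, (r : ℂ) ^ (a - 1) * laplaceRay q φ z₀ E μ l r) -
        ∑ m ∈ Finset.range S, (l : ℂ) ^ (-((m + a) / μ)) * (Complex.Gamma ((m + a) / μ) / μ) *
          E ^ m * (iteratedDeriv m (fun z => q z * (1 - φ z) ^ (-((m + a) / μ))) z₀ /
            m.factorial)‖ ≤ C * (K * l ^ (-((S + a.re) / μ))) := by
  have hμ0 : (0 : ℝ) < μ := by exact_mod_cast hμ
  have hSa : 0 < (S + a.re) := by positivity
  -- The pointwise constant times the integral of `r ^ (S + a.re - 1) e^{-l r^μ / 4}`, with `K` and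
  -- the power of `l` removed.
  refine ⟨laplaceConst S R ρ / R ^ S * ((4 : ℝ)⁻¹ ^ (-((S + a.re) / μ)) * (1 / μ) *
    Real.Gamma ((S + a.re) / μ)), ?_⟩
  intro q K hq hqb l hl
  have hK : 0 ≤ K := (norm_nonneg _).trans (hqb z₀ (Metric.mem_closedBall_self hR.le))
  have hnhds : Metric.closedBall z₀ R ∈ 𝓝 z₀ := Metric.closedBall_mem_nhds _ hR
  have hcoeff : ∀ m ∈ Finset.range S,
      iteratedDeriv m (fun z => q z * (1 - φ z) ^ (-((m + a) / μ))) z₀ / m.factorial =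
      ∑ j ∈ Finset.range S, Ring.choose ((m + a) / μ + j - 1) j * powTaylorCoeff q φ z₀ j m := by
    intro m hm
    rw [iteratedDeriv_mul_one_sub_cpow_neg (hq.analyticAt hnhds) (hφ.analyticAt hnhds) hφ0 _
      (Finset.mem_range.1 hm), Finset.sum_div]
    exact Finset.sum_congr rfl fun j _ => mul_div_assoc _ _ _
  rw [Finset.sum_congr rfl fun m hm => by rw [hcoeff m hm]]
  obtain ⟨hmi, hmv⟩ := laplaceModel_integral ha hl hμ S E (powTaylorCoeff q φ z₀)
  rw [← hmv]
  have hmaps : MapsTo (fun r : ℝ => z₀ + r * E) (Icc 0 ρ) (Metric.closedBall z₀ R) := by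
    intro r hr
    rw [Metric.mem_closedBall, dist_eq_norm, add_sub_cancel_left, norm_mul, hE, mul_one,
      Complex.norm_real, Real.norm_of_nonneg hr.1]
    linarith [hr.2]
  have hcont : ContinuousOn (laplaceRay q φ z₀ E μ l) (Icc 0 ρ) := by
    have hz : ContinuousOn (fun r : ℝ => z₀ + r * E) (Icc 0 ρ) := by fun_prop
    have h1 := hφ.continuousOn.comp hz hmaps
    have h2 := hq.continuousOn.comp hz hmaps
    refine ContinuousOn.mul (Complex.continuous_exp.comp_continuousOn ?_) h2
    exact (ContinuousOn.mul (by fun_prop) (continuousOn_const.sub h1)).neg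
  have hint : IntegrableOn (fun r : ℝ => (r : ℂ) ^ (a - 1) * laplaceRay q φ z₀ E μ l r)
      (Icc 0 ρ) := by
    refine IntegrableOn.mul_continuousOn ?_ hcont isCompact_Icc
    have := intervalIntegral.intervalIntegrable_cpow' (a := 0) (b := ρ) (r := a - 1) (by simpa)
    rwa [intervalIntegrable_iff_integrableOn_Icc_of_le hρ.le] at this
  refine ⟨hint, ?_⟩
  set f : ℝ → ℂ := fun r => (r : ℂ) ^ (a - 1) * laplaceRay q φ z₀ E μ l r with hf
  -- Extension by zero puts both integrals on the half-line, where one pointwise bound covers their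
  -- difference.
  have hI1 : ∫ r in Icc 0 ρ, f r = ∫ r in Ioi 0, (Ioc 0 ρ).indicator f r := by
    rw [integral_Icc_eq_integral_Ioc, setIntegral_indicator measurableSet_Ioc]
    congr 2
    exact (inter_eq_right.2 Ioc_subset_Ioi_self).symm
  have hI2 : IntegrableOn ((Ioc 0 ρ).indicator f) (Ioi 0) :=
    ((integrable_indicator_iff measurableSet_Ioc).2
      (hint.mono_set Ioc_subset_Icc_self)).integrableOn
  rw [hI1, ← integral_sub hI2 hmi]
  have hreal := integral_rpow_mul_exp_neg_mul_rpow (p := μ) (q := S + a.re - 1) (b := l / 4) hμ0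
    (by linarith) (by positivity)
  have hreali := integrableOn_rpow_mul_exp_neg_mul_rpow (p := μ) (s := S + a.re - 1) (b := l / 4)
    (by linarith) hμ0 (by positivity)
  have hbound : ∀ r ∈ Ioi (0 : ℝ), ‖(Ioc 0 ρ).indicator f r -
      (r : ℂ) ^ (a - 1) * laplaceModel S μ l E (powTaylorCoeff q φ z₀) r‖ ≤
      laplaceConst S R ρ * K / R ^ S *
        (r ^ (S + a.re - 1) * Real.exp (-(l / 4) * r ^ (μ : ℝ))) := by
    intro r hr
    have hr0 : 0 < r := hr
    have key : ‖(Ioc 0 ρ).indicator (laplaceRay q φ z₀ E μ l) r -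
        laplaceModel S μ l E (powTaylorCoeff q φ z₀) r‖ ≤
        laplaceConst S R ρ * K * (r / R) ^ S * Real.exp (-(l * r ^ μ / 4)) := by
      by_cases hrρ : r ≤ ρ
      · rw [indicator_of_mem (show r ∈ Ioc 0 ρ from ⟨hr, hrρ⟩)]
        refine (norm_laplaceRay_sub_model_le hR hφ hφb hφ0 hq hqb hE hl S hr0
          (hrρ.trans hρR)).trans ?_
        gcongr
        exact le_add_of_nonneg_right (by positivity)
      · rw [indicator_of_notMem (fun h => hrρ h.2), zero_sub, norm_neg]
        refine (norm_laplaceModel_le hR hφ hφb hq hqb hE hl S hρ (by linarith)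
          (not_le.1 hrρ)).trans ?_
        gcongr
        exact le_add_of_nonneg_left (by positivity)
    have hfi : (Ioc 0 ρ).indicator f r =
        (r : ℂ) ^ (a - 1) * (Ioc 0 ρ).indicator (laplaceRay q φ z₀ E μ l) r := by
      rw [hf, indicator_mul_right]
    rw [hfi, ← mul_sub, norm_mul, Complex.norm_cpow_eq_rpow_re_of_pos hr0, Complex.sub_re,
      Complex.one_re, Real.rpow_natCast, show (S : ℝ) + a.re - 1 = S + (a.re - 1) by ring,
      Real.rpow_add hr0, Real.rpow_natCast]
    calc _ ≤ r ^ (a.re - 1) *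
          (laplaceConst S R ρ * K * (r / R) ^ S * Real.exp (-(l * r ^ μ / 4))) := by gcongr
      _ = _ := by
        rw [div_pow, show -(l * r ^ μ / 4) = -(l / 4) * r ^ μ by ring]; ring
  refine (norm_integral_le_of_norm_le (hreali.const_mul _)
    ((ae_restrict_iff' measurableSet_Ioi).2 (ae_of_all _ hbound))).trans (le_of_eq ?_)
  rw [integral_const_mul, hreal, sub_add_cancel, div_eq_mul_inv l,
    Real.mul_rpow hl.le (by norm_num), neg_div]
  ring

/-! ### Phases, and absorption of exponentially small terms -/

/-- On the steepest-descent ray the leading term of the exponent is real and negative. -/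
theorem mul_exp_steepestAngle_pow {p₀ : ℂ} {μ : ℕ} (hμ : 1 ≤ μ) (k : ℤ) :
    p₀ * Complex.exp (Complex.I * (steepestAngle p₀ μ k : ℂ)) ^ μ = ((‖p₀‖ : ℝ) : ℂ) := by
  have hμc : (μ : ℂ) ≠ 0 := by exact_mod_cast (by omega : μ ≠ 0)
  have h : (μ : ℂ) * (Complex.I * (steepestAngle p₀ μ k : ℂ)) =
      -((p₀.arg : ℂ) * Complex.I) + k * (2 * Real.pi * Complex.I) := by
    simp only [steepestAngle]; push_cast; field_simp
  rw [← Complex.exp_nat_mul, h, Complex.exp_add, Complex.exp_int_mul_two_pi_mul_I, mul_one]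
  nth_rewrite 1 [← Complex.norm_mul_exp_arg_mul_I p₀]
  rw [mul_assoc, ← Complex.exp_add, add_neg_cancel, Complex.exp_zero, mul_one]

/-- The phase of the principal power of `p₀` and the factor containing `k` together make
`e^{iθ(m+a)}`: `e^{iθa}` comes from the branch and `dz`, `e^{iθm}` from `(r E) ^ m`. -/
theorem perronTerm_eq {q φ : ℂ → ℂ} {z₀ p₀ a : ℂ} {μ : ℕ} (hμ : 1 ≤ μ) (hp₀ : p₀ ≠ 0) (k : ℤ)
    {N : ℝ} (hN : 0 < N) (m : ℕ) :
    Complex.Gamma (((m : ℂ) + a) / (μ : ℂ)) *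
      (perronCoeff q φ z₀ p₀ a μ m *
        Complex.exp (2 * (Real.pi : ℂ) * Complex.I * (k : ℂ) * ((m : ℂ) + a) / (μ : ℂ))) /
      (N : ℂ) ^ (((m : ℂ) + a) / (μ : ℂ)) =
    Complex.exp (Complex.I * (steepestAngle p₀ μ k : ℂ) * a) *
      (((N * ‖p₀‖ : ℝ) : ℂ) ^ (-((m + a) / μ)) * (Complex.Gamma ((m + a) / μ) / μ) *
        Complex.exp (Complex.I * (steepestAngle p₀ μ k : ℂ)) ^ m *
        (iteratedDeriv m (fun z => q z * (1 - φ z) ^ (-((m + a) / μ))) z₀ / m.factorial)) := by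
  have hμc : (μ : ℂ) ≠ 0 := by exact_mod_cast (by omega : μ ≠ 0)
  have hNc : (N : ℂ) ≠ 0 := by exact_mod_cast hN.ne'
  have hn : 0 < ‖p₀‖ := norm_pos_iff.2 hp₀
  have hlog : ((Real.log (N * ‖p₀‖) : ℝ) : ℂ) = (Real.log N : ℝ) + (Real.log ‖p₀‖ : ℝ) := by
    rw [Real.log_mul hN.ne' hn.ne']; push_cast; rfl
  have key : p₀ ^ (-((m + a) / μ)) *
      Complex.exp (2 * (Real.pi : ℂ) * Complex.I * (k : ℂ) * ((m : ℂ) + a) / (μ : ℂ)) *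
      (N : ℂ) ^ (-((m + a) / μ)) =
      Complex.exp (Complex.I * (steepestAngle p₀ μ k : ℂ) * a) *
      ((N * ‖p₀‖ : ℝ) : ℂ) ^ (-((m + a) / μ)) *
        Complex.exp (Complex.I * (steepestAngle p₀ μ k : ℂ)) ^ m := by
    rw [Complex.cpow_def_of_ne_zero hp₀, Complex.cpow_def_of_ne_zero hNc,
      Complex.cpow_def_of_ne_zero (by exact_mod_cast (mul_pos hN hn).ne'),
      ← Complex.ofReal_log hN.le, ← Complex.ofReal_log (mul_pos hN hn).le, hlog,
      ← Complex.exp_nat_mul, ← Complex.exp_add, ← Complex.exp_add, ← Complex.exp_add,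
      ← Complex.exp_add, Complex.log]
    congr 1
    simp only [steepestAngle]; push_cast; field_simp; ring
  simp only [perronCoeff, neg_div]
  rw [div_eq_mul_inv _ ((N : ℂ) ^ (((m : ℂ) + a) / (μ : ℂ))), ← Complex.cpow_neg]
  have hf : (m.factorial : ℂ) ≠ 0 := by exact_mod_cast m.factorial_ne_zero
  set D := iteratedDeriv m (fun z => q z * (1 - φ z) ^ (-((m + a) / μ))) z₀
  calc _ = (Complex.Gamma (((m : ℂ) + a) / μ) / μ) * (D / m.factorial) * (p₀ ^ (-((m + a) / μ)) *
      Complex.exp (2 * (Real.pi : ℂ) * Complex.I * (k : ℂ) * ((m : ℂ) + a) / (μ : ℂ)) *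
      (N : ℂ) ^ (-((m + a) / μ))) := by field_simp
    _ = _ := by rw [key]; ring

/-- Raise `x ≤ e^x` at `x = N ε / β` to the power `β`. Being valid for every `N > 0`, it needs no
threshold. -/
theorem Real.exp_neg_mul_le_rpow {ε β N : ℝ} (hε : 0 < ε) (hβ : 0 < β) (hN : 0 < N) :
    Real.exp (-(N * ε)) ≤ (ε / β) ^ (-β) * N ^ (-β) := by
  have h1 : N * ε / β ≤ Real.exp (N * ε / β) := by
    have := Real.add_one_le_exp (N * ε / β); linarith
  have h2 := Real.rpow_le_rpow (by positivity) h1 hβ.le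
  rw [← Real.exp_mul, div_mul_cancel₀ _ hβ.ne'] at h2
  rw [← Real.mul_rpow (by positivity) hN.le, show ε / β * N = N * ε / β by ring,
    Real.rpow_neg (by positivity), Real.exp_neg]
  exact inv_anti₀ (by positivity) h2

/-! ### The two pieces of the contour -/

/-- An initial parameter interval of a contour on which it is a `C¹` parametrization of a
segment of the half-line with direction `θ`. -/
theorem exists_initial_ray {c : ℝ → ℂ} (hc : IsContour c) {z₀ : ℂ} (hc0 : c 0 = z₀) {θ : ℝ}
    (hrun : InitiallyRunsAlong c z₀ θ) {ϑ : ℝ → ℝ} (hϑ : IsContinuousArgAlong c z₀ θ ϑ)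
    {r₀ : ℝ} (hr₀ : 0 < r₀) :
    ∃ t₁ ∈ Ioo (0 : ℝ) 1, ‖c t₁ - z₀‖ ≤ r₀ ∧ (∀ t ∈ Ioo 0 t₁, ϑ t = θ) ∧
      (∀ t ∈ Icc 0 t₁, c t = z₀ + ((‖c t - z₀‖ : ℝ) : ℂ) * Complex.exp (Complex.I * (θ : ℂ))) ∧
      MonotoneOn (fun t => ‖c t - z₀‖) (Icc 0 t₁) ∧
      ∃ r' : ℝ → ℝ, ∀ t ∈ Ioo 0 t₁, HasDerivAt (fun t => ‖c t - z₀‖) (r' t) t ∧ 0 ≤ r' t ∧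
        deriv c t = r' t * Complex.exp (Complex.I * (θ : ℂ)) := by
  obtain ⟨δ, hδ, hray, hmono⟩ := hrun
  obtain ⟨X, hX, hcX⟩ := hc.piecewise_C1
  have hct : Tendsto (fun t => ‖c t - z₀‖) (𝓝[>] 0) (𝓝 0) := by
    have h : ContinuousWithinAt c (Icc 0 1) 0 := hc.continuousOn 0 (by simp)
    have h2 : Tendsto c (𝓝[>] 0) (𝓝 z₀) := by
      have := h.tendsto
      rw [hc0] at this
      refine this.mono_left ?_
      rw [← nhdsWithin_Ioc_eq_nhdsGT (zero_lt_one' ℝ)]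
      exact nhdsWithin_mono _ Ioc_subset_Icc_self
    simpa using (h2.sub_const z₀).norm
  have hXn : ∀ᶠ t in 𝓝[>] (0 : ℝ), t ∉ X := by
    have : (X \ {0})ᶜ ∈ 𝓝 (0 : ℝ) :=
      (hX.subset sdiff_subset).isClosed.isOpen_compl.mem_nhds (by simp)
    filter_upwards [mem_nhdsWithin_of_mem_nhds this, self_mem_nhdsWithin] with t h1 h2 h3
    exact h1 ⟨h3, ne_of_gt h2⟩
  have hev : ∀ᶠ t in 𝓝[>] (0 : ℝ), ϑ t = θ ∧ t ∉ X ∧ ‖c t - z₀‖ ≤ r₀ ∧ t < 1 ∧ t ≤ δ := by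
    filter_upwards [hϑ.initial, hXn, hct.eventually_le_const hr₀,
      mem_nhdsWithin_of_mem_nhds (Iio_mem_nhds zero_lt_one),
      mem_nhdsWithin_of_mem_nhds (Iic_mem_nhds hδ.1)] with t h1 h2 h3 h4 h5
    exact ⟨h1, h2, h3, h4, h5⟩
  obtain ⟨t₁, ht₁, hsub⟩ := mem_nhdsGT_iff_exists_Ioc_subset.1 hev
  have h1 := hsub (right_mem_Ioc.2 ht₁)
  have hray' : ∀ t ∈ Icc 0 t₁,
      c t = z₀ + ((‖c t - z₀‖ : ℝ) : ℂ) * Complex.exp (Complex.I * (θ : ℂ)) :=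
    fun t ht => hray t ⟨ht.1, ht.2.trans h1.2.2.2.2⟩
  have hmono' : MonotoneOn (fun t => ‖c t - z₀‖) (Icc 0 t₁) :=
    hmono.mono (Icc_subset_Icc_right h1.2.2.2.2)
  refine ⟨t₁, ⟨ht₁, h1.2.2.2.1⟩, h1.2.2.1, fun t ht => (hsub (Ioo_subset_Ioc_self ht)).1,
    hray', hmono', deriv fun t => ‖c t - z₀‖, fun t ht => ?_⟩
  have htX := hsub (Ioo_subset_Ioc_self ht)
  have hopen : IsOpen (Ioo (0 : ℝ) 1 \ X) := isOpen_Ioo.sdiff hX.isClosed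
  have hcd : DifferentiableAt ℝ c t :=
    (hcX.differentiableOn one_ne_zero).differentiableAt
      (hopen.mem_nhds ⟨⟨ht.1, htX.2.2.2.1⟩, htX.2.1⟩)
  have hrd : DifferentiableAt ℝ (fun t => ‖c t - z₀‖) t := by
    -- The norm is not differentiable at 0, but on the ray it is a real-linear function of `c t -
    -- z₀`: rotate by `-θ` and take the real part.
    have hre : (fun t => ‖c t - z₀‖) =ᶠ[𝓝 t]
        fun t => Complex.reCLM ((c t - z₀) * Complex.exp (-(Complex.I * (θ : ℂ)))) := by
      filter_upwards [Ioo_mem_nhds ht.1 ht.2] with u hu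
      nth_rewrite 2 [hray' u (Ioo_subset_Icc_self hu)]
      rw [add_sub_cancel_left, mul_assoc, ← Complex.exp_add, add_neg_cancel, Complex.exp_zero,
        mul_one, Complex.reCLM_apply, Complex.ofReal_re]
    refine DifferentiableAt.congr_of_eventuallyEq ?_ hre
    exact Complex.reCLM.differentiableAt.comp t ((hcd.sub_const _).mul_const _)
  refine ⟨hrd.hasDerivAt, ?_, ?_⟩
  · have := hmono'.derivWithin_nonneg (x := t)
    rwa [derivWithin_of_mem_nhds (Icc_mem_nhds ht.1 ht.2)] at this
  · have hce : c =ᶠ[𝓝 t]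
        fun t => z₀ + ((‖c t - z₀‖ : ℝ) : ℂ) * Complex.exp (Complex.I * (θ : ℂ)) := by
      filter_upwards [Ioo_mem_nhds ht.1 ht.2] with u hu using hray' u (Ioo_subset_Icc_self hu)
    rw [hce.deriv_eq]
    exact ((hrd.hasDerivAt.ofReal_comp.mul_const _).const_add z₀).deriv

/-- The initial part of the contour integral is an integral along a ray. -/
theorem perronIntegrand_initial {c : ℝ → ℂ} (hcc : ContinuousOn c (Icc 0 1)) {z₀ : ℂ}
    (hc0 : c 0 = z₀) {θ : ℝ} {ϑ : ℝ → ℝ} {t₁ : ℝ} (ht₁ : t₁ ∈ Ioo (0 : ℝ) 1)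
    (hϑ : ∀ t ∈ Ioo 0 t₁, ϑ t = θ)
    (hray : ∀ t ∈ Icc 0 t₁,
      c t = z₀ + ((‖c t - z₀‖ : ℝ) : ℂ) * Complex.exp (Complex.I * (θ : ℂ)))
    {r' : ℝ → ℝ} (hr' : ∀ t ∈ Ioo 0 t₁, HasDerivAt (fun t => ‖c t - z₀‖) (r' t) t ∧ 0 ≤ r' t ∧
      deriv c t = r' t * Complex.exp (Complex.I * (θ : ℂ)))
    {p q φ : ℂ → ℂ} {p₀ a : ℂ} {μ : ℕ}
    (hθ : p₀ * Complex.exp (Complex.I * (θ : ℂ)) ^ μ = ((‖p₀‖ : ℝ) : ℂ))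
    (hpφ : ∀ t ∈ Ioo 0 t₁, p (c t) = p z₀ - p₀ * (c t - z₀) ^ μ * (1 - φ (c t))) (N : ℝ)
    (hint : IntegrableOn (fun r : ℝ => (r : ℂ) ^ (a - 1) *
      laplaceRay q φ z₀ (Complex.exp (Complex.I * (θ : ℂ))) μ (N * ‖p₀‖) r)
      (Icc 0 ‖c t₁ - z₀‖)) :
    IntervalIntegrable (perronIntegrand c p q z₀ a ϑ N) volume 0 t₁ ∧
    ∫ t in (0 : ℝ)..t₁, perronIntegrand c p q z₀ a ϑ N t =
      Complex.exp (N * p z₀) * Complex.exp (Complex.I * (θ : ℂ) * a) *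
        ∫ r in Icc 0 ‖c t₁ - z₀‖, (r : ℂ) ^ (a - 1) *
          laplaceRay q φ z₀ (Complex.exp (Complex.I * (θ : ℂ))) μ (N * ‖p₀‖) r := by
  set E := Complex.exp (Complex.I * (θ : ℂ)) with hE
  set g : ℝ → ℂ := fun r => (r : ℂ) ^ (a - 1) * laplaceRay q φ z₀ E μ (N * ‖p₀‖) r with hg
  set A := Complex.exp (N * p z₀) * Complex.exp (Complex.I * (θ : ℂ) * a) with hA
  have hpt : ∀ t ∈ Ioo 0 t₁, perronIntegrand c p q z₀ a ϑ N t =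
      A * (r' t • g ‖c t - z₀‖) := by
    intro t ht
    have hct := hray t (Ioo_subset_Icc_self ht)
    have hsub : c t - z₀ = ((‖c t - z₀‖ : ℝ) : ℂ) * E := by
      nth_rewrite 1 [hct]; exact add_sub_cancel_left _ _
    have h1 : Complex.exp (N * p (c t)) = Complex.exp (N * p z₀) *
        Complex.exp (-(((N * ‖p₀‖ * ‖c t - z₀‖ ^ μ : ℝ) : ℂ) * (1 - φ (c t)))) := by
      rw [← Complex.exp_add, hpφ t ht]
      congr 1
      have : p₀ * (c t - z₀) ^ μ = ((‖p₀‖ : ℝ) : ℂ) * ((‖c t - z₀‖ : ℝ) : ℂ) ^ μ := by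
        nth_rewrite 1 [hsub]
        rw [mul_pow, ← hθ]; ring
      rw [this]; push_cast; ring
    have h2 : Complex.exp (Complex.I * (θ : ℂ) * a) =
        Complex.exp (Complex.I * (θ : ℂ) * (a - 1)) * E := by
      rw [hE, ← Complex.exp_add]; ring_nf
    simp only [perronIntegrand, branchPow, hg, laplaceRay, Complex.real_smul]
    rw [← hct, h1, (hr' t ht).2.2, hϑ t ht, hA, h2]
    ring
  have hrc : ContinuousOn (fun t => ‖c t - z₀‖) (Icc 0 t₁) :=
    ((hcc.mono (Icc_subset_Icc_right ht₁.2.le)).sub continuousOn_const).norm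
  have hr0 : ‖c 0 - z₀‖ = 0 := by simp [hc0]
  -- The radius may be constant on subintervals, so the substitution uses only a nonnegative
  -- derivative, not injectivity.
  have hI := integrableOn_Icc_deriv_smul_iff_of_deriv_nonneg (g := g) hrc
    (fun t ht => (hr' t ht).1) (fun t ht => (hr' t ht).2.1) ht₁.1.le
  have hV := integral_Icc_deriv_smul_of_deriv_nonneg (g := g) hrc
    (fun t ht => (hr' t ht).1) (fun t ht => (hr' t ht).2.1) ht₁.1.le
  simp only [hr0] at hI hV
  constructor
  · rw [intervalIntegrable_iff_integrableOn_Ioo_of_le ht₁.1.le]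
    refine IntegrableOn.congr_fun (f := fun t => A * (r' t • g ‖c t - z₀‖)) ?_
      (fun t ht => (hpt t ht).symm) measurableSet_Ioo
    exact ((hI.2 hint).mono_set Ioo_subset_Icc_self).const_mul A
  · rw [intervalIntegral.integral_of_le ht₁.1.le, integral_Ioc_eq_integral_Ioo,
      setIntegral_congr_fun measurableSet_Ioo hpt, integral_const_mul, ← hV,
      integral_Icc_eq_integral_Ioo]

/-- Away from its starting point, the contour contributes an exponentially small amount. -/
theorem perronIntegrand_tail {c : ℝ → ℂ} (hc : IsContour c) {z₀ a : ℂ} {θ : ℝ} {ϑ : ℝ → ℝ}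
    (hϑ : IsContinuousArgAlong c z₀ θ ϑ) (hne : ∀ t ∈ Ioc (0 : ℝ) 1, c t ≠ z₀)
    {p : ℂ → ℂ} (hp : ContinuousOn p (c '' Icc 0 1))
    (hmax : ∀ z ∈ c '' Icc (0 : ℝ) 1, z ≠ z₀ → (p z).re < (p z₀).re)
    {t₁ : ℝ} (ht₁ : t₁ ∈ Ioo (0 : ℝ) 1) :
    ∃ ε B : ℝ, 0 < ε ∧ 0 ≤ B ∧ ∀ (q : ℂ → ℂ) (K : ℝ), ContinuousOn q (c '' Icc 0 1) →
      (∀ z ∈ c '' Icc (0 : ℝ) 1, ‖q z‖ ≤ K) → ∀ N : ℝ, 0 < N →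
      IntervalIntegrable (perronIntegrand c p q z₀ a ϑ N) volume t₁ 1 ∧
      ‖∫ t in t₁..1, perronIntegrand c p q z₀ a ϑ N t‖ ≤
        Real.exp (N * (p z₀).re) * (Real.exp (-(N * ε)) * (B * K)) := by
  have hsub : Icc t₁ 1 ⊆ Icc 0 1 := Icc_subset_Icc_left ht₁.1.le
  have hsub' : Icc t₁ 1 ⊆ Ioc 0 1 := fun t ht => ⟨ht₁.1.trans_le ht.1, ht.2⟩
  have hcc : ContinuousOn c (Icc t₁ 1) := hc.continuousOn.mono hsub
  have hmaps : MapsTo c (Icc t₁ 1) (c '' Icc 0 1) := (mapsTo_image c _).mono_left hsub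
  have hpc : ContinuousOn (fun t => p (c t)) (Icc t₁ 1) := hp.comp hcc hmaps
  have hnonempty : (Icc t₁ 1).Nonempty := nonempty_Icc.2 ht₁.2.le
  -- By compactness `Re p` attains its maximum over the tail at `s`; the gap there is `ε`, and `B`
  -- is a bound for the branch times the length of the tail.
  obtain ⟨s, hs, hsmax⟩ := isCompact_Icc.exists_isMaxOn hnonempty
    (Complex.continuous_re.comp_continuousOn hpc)
  have hbr : ContinuousOn (fun t => branchPow (c t - z₀) (ϑ t) (a - 1)) (Icc t₁ 1) := by
    have hn : ContinuousOn (fun t => ((‖c t - z₀‖ : ℝ) : ℂ)) (Icc t₁ 1) :=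
      Complex.continuous_ofReal.comp_continuousOn (hcc.sub continuousOn_const).norm
    have hth : ContinuousOn (fun t => (ϑ t : ℂ)) (Icc t₁ 1) :=
      Complex.continuous_ofReal.comp_continuousOn (hϑ.continuousOn.mono hsub')
    refine ContinuousOn.mul (hn.cpow_const fun t ht => ?_) ?_
    · exact Complex.ofReal_mem_slitPlane.2
        (norm_pos_iff.2 (sub_ne_zero.2 (hne t (hsub' ht))))
    · exact Complex.continuous_exp.comp_continuousOn
        ((continuousOn_const.mul hth).mul continuousOn_const)
  obtain ⟨M, hM⟩ := isCompact_Icc.exists_bound_of_continuousOn hbr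
  have hM0 : 0 ≤ M := (norm_nonneg _).trans (hM s hs)
  have hdi : IntervalIntegrable (deriv c) volume t₁ 1 :=
    hc.finite_length.mono_set (by
      rw [uIcc_of_le ht₁.2.le, uIcc_of_le zero_le_one]; exact hsub)
  have hlen : 0 ≤ ∫ t in t₁..1, ‖deriv c t‖ :=
    intervalIntegral.integral_nonneg ht₁.2.le fun t _ => norm_nonneg _
  refine ⟨(p z₀).re - (p (c s)).re, M * ∫ t in t₁..1, ‖deriv c t‖,
    sub_pos.2 (hmax _ (hmaps hs) (hne s (hsub' hs))), mul_nonneg hM0 hlen, ?_⟩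
  intro q K hq hqK N hN
  have hqc : ContinuousOn (fun t => q (c t)) (Icc t₁ 1) := hq.comp hcc hmaps
  constructor
  · have hcont : ContinuousOn (fun t => Complex.exp ((N : ℂ) * p (c t)) *
        branchPow (c t - z₀) (ϑ t) (a - 1) * q (c t)) (uIcc t₁ 1) := by
      rw [uIcc_of_le ht₁.2.le]
      exact ((Complex.continuous_exp.comp_continuousOn
        (continuousOn_const.mul hpc)).mul hbr).mul hqc
    exact hdi.continuousOn_mul hcont
  · have hK : 0 ≤ K := (norm_nonneg _).trans (hqK _ (hmaps hs))
    have hb : ∀ t ∈ Ioc t₁ 1, ‖perronIntegrand c p q z₀ a ϑ N t‖ ≤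
        Real.exp (N * (p (c s)).re) * M * K * ‖deriv c t‖ := by
      intro t ht
      have ht' := Ioc_subset_Icc_self ht
      have hre : (p (c t)).re ≤ (p (c s)).re := hsmax ht'
      simp only [perronIntegrand, norm_mul, Complex.norm_exp, Complex.re_ofReal_mul]
      gcongr
      · exact hM t ht'
      · exact hqK _ (hmaps ht')
    refine (intervalIntegral.norm_integral_le_of_norm_le ht₁.2.le (ae_of_all _ hb)
      (hdi.norm.const_mul _)).trans (le_of_eq ?_)
    rw [intervalIntegral.integral_const_mul, ← mul_assoc, ← Real.exp_add]
    ring_nf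

/-! ### Assembly -/

theorem theorem6p1
    (z₀ z₁ : ℂ) (nb : Set ℂ) (hnb : nb ∈ 𝓝 z₀)
    -- the contour, from `z₀` to `z₁`, which meets `z₀` only at its start
    (c : ℝ → ℂ) (hc : IsContour c) (hc0 : c 0 = z₀) (hc1 : c 1 = z₁) (hz : z₀ ≠ z₁)
    (hne : ∀ t ∈ Ioc (0 : ℝ) 1, c t ≠ z₀)
    -- the exponent and its local form at `z₀`
    (p : ℂ → ℂ) (hp : HolomorphicOnDomainContaining p (nb ∪ c '' Icc 0 1))
    (μ : ℕ) (hμ : 1 ≤ μ) (p₀ : ℂ) (hp₀ : p₀ ≠ 0)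
    (φ : ℂ → ℂ) (hφ : DifferentiableOn ℂ φ nb) (hφ0 : φ z₀ = 0)
    (hpφ : ∀ z ∈ nb, p z = p z₀ - p₀ * (z - z₀) ^ μ * (1 - φ z))
    (k : ℤ) (hrun : InitiallyRunsAlong c z₀ (steepestAngle p₀ μ k))
    (a : ℂ) (ha : 0 < a.re)
    (hmax : ∀ z ∈ c '' Icc (0 : ℝ) 1, z ≠ z₀ → (p z).re < (p z₀).re)
    -- the branch of the argument of `z - z₀` along the contour
    (ϑ : ℝ → ℝ) (hϑ : IsContinuousArgAlong c z₀ (steepestAngle p₀ μ k) ϑ)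
    (S : ℕ) :
    ∃ C : ℝ, ∀ (q : ℂ → ℂ) (Kq : ℝ),
      HolomorphicOnDomainContaining q (nb ∪ c '' Icc 0 1) →
      (∀ z ∈ nb ∪ c '' Icc (0 : ℝ) 1, ‖q z‖ ≤ Kq) →
      ∀ N : ℝ, 0 < N →
        IntervalIntegrable (perronIntegrand c p q z₀ a ϑ N) MeasureTheory.volume 0 1 ∧
        ∃ R : ℂ, ‖R‖ ≤ C * (Kq / N ^ (((S : ℝ) + a.re) / (μ : ℝ))) ∧
          ∫ t in (0 : ℝ)..1, perronIntegrand c p q z₀ a ϑ N t =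
            Complex.exp ((N : ℂ) * p z₀) *
              (∑ s ∈ Finset.range S,
                Complex.Gamma (((s : ℂ) + a) / (μ : ℂ)) *
                  (perronCoeff q φ z₀ p₀ a μ s *
                    Complex.exp (2 * (Real.pi : ℂ) * Complex.I * (k : ℂ) * ((s : ℂ) + a) / (μ : ℂ))) /
                  (N : ℂ) ^ (((s : ℂ) + a) / (μ : ℂ)) + R) := by
  obtain ⟨R, hR, hball, hφb⟩ : ∃ R : ℝ, 0 < R ∧ Metric.closedBall z₀ R ⊆ nb ∧
      ∀ z ∈ Metric.closedBall z₀ R, ‖φ z‖ ≤ 1 / 2 := by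
    have hφc : ContinuousAt φ z₀ := (hφ.differentiableAt hnb).continuousAt
    have hev : ∀ᶠ z in 𝓝 z₀, ‖φ z‖ ≤ 1 / 2 :=
      hφc.norm.tendsto.eventually_le_const (by simp [hφ0])
    obtain ⟨R, hR, h⟩ := Metric.nhds_basis_closedBall.mem_iff.1 (inter_mem hnb hev)
    exact ⟨R, hR, fun z hz => (h hz).1, fun z hz => (h hz).2⟩
  obtain ⟨t₁, ht₁, hρR, hϑ₁, hray, hmono, r', hr'⟩ :=
    exists_initial_ray hc hc0 hrun hϑ (half_pos hR)
  set θ := steepestAngle p₀ μ k with hθ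
  set E := Complex.exp (Complex.I * (θ : ℂ)) with hE
  have hEn : ‖E‖ = 1 := by rw [hE, mul_comm]; exact Complex.norm_exp_ofReal_mul_I θ
  have hρ : 0 < ‖c t₁ - z₀‖ := norm_pos_iff.2 (sub_ne_zero.2 (hne t₁ (Ioo_subset_Ioc_self ht₁)))
  obtain ⟨C₁, hloc⟩ := laplaceRay_asymptotics (μ := μ) (a := a) hR (hφ.mono hball) hφb hφ0 hEn
    hρ hρR ha hμ S
  obtain ⟨Dp, hDp, -, hsubp, hpd⟩ := hp
  obtain ⟨ε, B, hε, hB, htail⟩ := perronIntegrand_tail (a := a) hc hϑ hne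
    (hpd.continuousOn.mono (subset_union_right.trans hsubp)) hmax ht₁
  have hμ0 : (0 : ℝ) < μ := by exact_mod_cast hμ
  have hn : 0 < ‖p₀‖ := norm_pos_iff.2 hp₀
  set β : ℝ := (S + a.re) / μ with hβ
  have hβ0 : 0 < β := by positivity
  set A := Complex.exp (Complex.I * (θ : ℂ) * a) with hA
  -- The first summand is the ray error with `l = N ‖p₀‖`, the second the tail. All the ingredients
  -- were fixed before `q` and `N`.
  refine ⟨‖A‖ * C₁ * ‖p₀‖ ^ (-β) + (ε / β) ^ (-β) * B, fun q Kq hq hqK N hN => ?_⟩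
  obtain ⟨Dq, hDq, -, hsubq, hqd⟩ := hq
  have hqnb : DifferentiableOn ℂ q (Metric.closedBall z₀ R) :=
    hqd.mono (hball.trans (subset_union_left.trans hsubq))
  have hl : 0 < N * ‖p₀‖ := mul_pos hN hn
  obtain ⟨hint, hJ⟩ := hloc q Kq hqnb (fun z hz => hqK z (Or.inl (hball hz))) (N * ‖p₀‖) hl
  have hpφ' : ∀ t ∈ Ioo 0 t₁, p (c t) = p z₀ - p₀ * (c t - z₀) ^ μ * (1 - φ (c t)) := by
    intro t ht
    refine hpφ _ (hball ?_)
    rw [Metric.mem_closedBall, dist_eq_norm]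
    have := hmono (Ioo_subset_Icc_self ht) (right_mem_Icc.2 ht₁.1.le) ht.2.le
    simp only at this
    linarith
  obtain ⟨hi₁, hv₁⟩ := perronIntegrand_initial hc.continuousOn hc0 ht₁ hϑ₁ hray hr'
    (mul_exp_steepestAngle_pow hμ k) hpφ' N hint
  obtain ⟨hi₂, hv₂⟩ := htail q Kq (hqd.continuousOn.mono (subset_union_right.trans hsubq))
    (fun z hz => hqK z (Or.inr hz)) N hN
  refine ⟨hi₁.trans hi₂, ?_⟩
  rw [← intervalIntegral.integral_add_adjacent_intervals hi₁ hi₂, hv₁,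
    Finset.sum_congr rfl fun m _ => perronTerm_eq hμ hp₀ k hN m, ← Finset.mul_sum, ← hθ,
    ← hE, ← hA]
  set J := ∫ r in Icc 0 ‖c t₁ - z₀‖, (r : ℂ) ^ (a - 1) * laplaceRay q φ z₀ E μ (N * ‖p₀‖) r
  set I₂ := ∫ t in t₁..1, perronIntegrand c p q z₀ a ϑ N t
  set T := ∑ m ∈ Finset.range S, (((N * ‖p₀‖ : ℝ) : ℂ) ^ (-((m + a) / μ)) *
    (Complex.Gamma ((m + a) / μ) / μ) * E ^ m *
      (iteratedDeriv m (fun z => q z * (1 - φ z) ^ (-((m + a) / μ))) z₀ / m.factorial))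
  -- The tail does not carry the prefactor `e^{N p z₀}`, so it is divided out.
  refine ⟨A * (J - T) + Complex.exp (-(N * p z₀)) * I₂, ?_, ?_⟩
  · have hKq : 0 ≤ Kq := (norm_nonneg _).trans (hqK z₀ (Or.inl (mem_of_mem_nhds hnb)))
    have h₁ : ‖A * (J - T)‖ ≤ ‖A‖ * (C₁ * (Kq * (N * ‖p₀‖) ^ (-β))) := by
      rw [norm_mul]; gcongr
    have h₂ : ‖Complex.exp (-(N * p z₀)) * I₂‖ ≤ (ε / β) ^ (-β) * N ^ (-β) * (B * Kq) := by
      rw [norm_mul, Complex.norm_exp, Complex.neg_re, Complex.re_ofReal_mul]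
      calc _ ≤ Real.exp (-(N * (p z₀).re)) *
            (Real.exp (N * (p z₀).re) * (Real.exp (-(N * ε)) * (B * Kq))) := by gcongr
        _ = Real.exp (-(N * ε)) * (B * Kq) := by
            rw [← mul_assoc, ← Real.exp_add, neg_add_cancel, Real.exp_zero, one_mul]
        _ ≤ _ := by gcongr; exact Real.exp_neg_mul_le_rpow hε hβ0 hN
    refine (norm_add_le_of_le h₁ h₂).trans (le_of_eq ?_)
    rw [Real.mul_rpow hN.le hn.le, div_eq_mul_inv Kq, ← Real.rpow_neg hN.le]
    ring
  · have hexp : Complex.exp (N * p z₀) * Complex.exp (-(N * p z₀)) = 1 := by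
      rw [← Complex.exp_add, add_neg_cancel, Complex.exp_zero]
    linear_combination (-I₂) * hexp
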